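/- Let $W$ be Lambert's function, the inverse of $x\mapsto xe^x$ on $[0,\infty)$, and let $F_*$ be the probability distribution on $[0,\infty)$ with $1-F_*(y)=W(1)e^{-y}$ for $y\ge 0$ (so $F_*$ has an atom of mass $1-W(1)$ at $0$). Let $\mathcal T$ be the Poisson weighted infinite tree: its vertices are the finite words over $\{1,2,\dots\}$, its root $\phi$ is the empty word, its edges are $\{v,v.i\}$ for $i\ge1$, and the edge $\{v,v.i\}$ has length $\xi(v,v.i)=\xi(v.i,v)=\xi^v_i$, where $\xi^v_1<\xi^v_2<\cdots$ are the points of independent Poisson processes of intensity $1$ on $[0,\infty)$, one for each vertex $v$. Let $X(u,v)$, for all directed edges $(u,v)$ of $\mathcal T$, be random variables such that almost surely, for every directed edge $(u,v)$, $$X(u,v)=\min\bigl\{(\xi(v,w)-X(v,w))^+ : w\sim v,\ w\neq u\bigr\},$$ and such that, for every $d\ge1$, the variables $X(v,w)$ with $v$ at depth $d-1$ and $w$ at depth $d$ are independent, have distribution $F_*$, and are jointly independent of the lengths of all edges between vertices of depth at most $d$. For a vertex $v$ let $\mathcal C_{\mathrm{opt}}(v)$ be the set of all neighbours $y$ of $v$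 that minimise $(\xi(v,y)-X(v,y))^+$ among the neighbours of $v$. Then $$\mathbb E\Bigl[\sum_{v\in\mathcal C_{\mathrm{opt}}(\phi)}\xi(\phi,v)\Bigr]=2W(1)+W(1)^2 .$$ -/

import Mathlib

open MeasureTheory ProbabilityTheory

namespace PWIT

/-! ### Lambert's function and the law `F_*` -/

/-- Lambert's `W`-function: the inverse of `x ↦ x * exp x` on `[0, ∞)`. -/
noncomputable def lambertW (y : ℝ) : ℝ :=
  Function.invFunOn (fun x : ℝ => x * Real.exp x) (Set.Ici 0) y

/-- `lambertW y` is the only `x ≥ 0` with `x * exp x = y`, for every `y ≥ 0`. -/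
theorem lambertW_eq_iff {x y : ℝ} (hx : 0 ≤ x) (hy : 0 ≤ y) :
    lambertW y = x ↔ x * Real.exp x = y := by
  have hinj : Set.InjOn (fun x : ℝ => x * Real.exp x) (Set.Ici 0) := by
    apply StrictMonoOn.injOn
    intro a ha b _ hab
    have ha' : (0 : ℝ) ≤ a := ha
    exact mul_lt_mul hab (Real.exp_le_exp.2 hab.le) (Real.exp_pos a) (ha'.trans hab.le)
  have hex : ∃ a ∈ Set.Ici (0 : ℝ), (fun x : ℝ => x * Real.exp x) a = y := by
    have h1 : y ∈ Set.Icc ((fun x : ℝ => x * Real.exp x) 0) ((fun x : ℝ => x * Real.exp x) y) := by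
      refine ⟨by simpa using hy, ?_⟩
      have h2 : (1 : ℝ) ≤ Real.exp y := Real.one_le_exp hy
      show y ≤ y * Real.exp y
      nlinarith
    have h3 : ContinuousOn (fun x : ℝ => x * Real.exp x) (Set.Icc 0 y) := by fun_prop
    obtain ⟨a, ha, hay⟩ := intermediate_value_Icc hy h3 h1
    exact ⟨a, ha.1, hay⟩
  have hmem := Function.invFunOn_mem hex
  have heq := Function.invFunOn_eq hex
  constructor
  · rintro rfl
    exact heq
  · intro h
    exact hinj hmem hx (heq.trans h.symm)

/-- The complementary distribution function of `F_*`. -/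
noncomputable def fStarTail (y : ℝ) : ℝ :=
  if 0 ≤ y then lambertW 1 * Real.exp (-y) else 1

/-- The random variable `Z` has distribution `F_*`: its complementary distribution function
`y ↦ P(Z > y)` is `fStarTail`. -/
def HasFStarLaw {Ω : Type*} [MeasurableSpace Ω] (Z : Ω → ℝ) (μ : Measure Ω) : Prop :=
  AEMeasurable Z μ ∧ ∀ y : ℝ, μ {ω | y < Z ω} = ENNReal.ofReal (fStarTail y)

/-! ### The tree

Vertices are the finite words over the alphabet `ℕ` (letter `i` here is the letter `i + 1` of the
alphabet `{1, 2, …}`). A word is stored with its last letter at the head of the list, so that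
`i :: v` is the word `v` followed by the letter `i`, that is, the `i`-th child of `v`. The root is
the empty word `[]`. -/

/-- The infinite tree with edges `{v, v.i}`. -/
def tree : SimpleGraph (List ℕ) :=
  SimpleGraph.fromRel fun v w => ∃ i : ℕ, w = i :: v

/-- Length of the edge from a vertex to its parent, when the edge from `v` to its `i`-th child has
length `ξ v i` (value `0` at the root, which has no parent). -/
def parentLength (ξ : List ℕ → ℕ → ℝ) : List ℕ → ℝ
  | [] => 0
  | i :: v => ξ v i

/-- Length `ξ(u, w) = ξ(w, u)` of the edge `{u, w}`; only meaningful for adjacent `u` and `w`. -/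
def edgeLength (ξ : List ℕ → ℕ → ℝ) (u w : List ℕ) : ℝ :=
  if u.length < w.length then parentLength ξ w else parentLength ξ u

section Check

/-- The neighbours of the root are its children. -/
theorem tree_adj_root (w : List ℕ) : tree.Adj [] w ↔ ∃ i : ℕ, w = [i] := by
  constructor
  · rintro ⟨_, h⟩
    simpa using h
  · rintro ⟨i, rfl⟩
    exact ⟨by simp, Or.inl ⟨i, rfl⟩⟩

/-- A vertex other than the root has its parent and its children as neighbours. -/
theorem tree_adj_cons (j : ℕ) (v w : List ℕ) :
    tree.Adj (j :: v) w ↔ w = v ∨ ∃ i : ℕ, w = i :: j :: v := by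
  constructor
  · rintro ⟨_, ⟨i, h⟩ | ⟨i, h⟩⟩
    · exact Or.inr ⟨i, h⟩
    · exact Or.inl (List.cons.inj h).2.symm
  · rintro (rfl | ⟨i, rfl⟩)
    · exact ⟨by simp, Or.inr ⟨j, rfl⟩⟩
    · exact ⟨by simp, Or.inl ⟨i, rfl⟩⟩

theorem edgeLength_child (ξ : List ℕ → ℕ → ℝ) (v : List ℕ) (i : ℕ) :
    edgeLength ξ v (i :: v) = ξ v i ∧ edgeLength ξ (i :: v) v = ξ v i := by
  simp [edgeLength, parentLength]

end Check

/-! ### The random tree -/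

/-- `τ 0 < τ 1 < ⋯` are the points, in increasing order, of a Poisson process of intensity `1` on
`(0, ∞)`: the gaps `τ 0, τ 1 - τ 0, τ 2 - τ 1, …` are independent and exponential with mean `1`. -/
def IsUnitPoissonProcess {Ω : Type*} [MeasurableSpace Ω] (τ : ℕ → Ω → ℝ) (μ : Measure Ω) : Prop :=
  HasLaw (τ 0) (expMeasure 1) μ ∧
  (∀ i, HasLaw (fun ω => τ (i + 1) ω - τ i ω) (expMeasure 1) μ) ∧
  iIndepFun (fun (i : ℕ) ω => τ i ω - (if i = 0 then 0 else τ (i - 1) ω)) μ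

/-- The random edge lengths `ξ` (`ξ v i` is the length of the edge `{v, v.i}`) make the tree a
Poisson weighted infinite tree: the sequences `(ξ v i)_i`, for `v` ranging over the vertices, are
independent Poisson processes of intensity `1`. -/
structure IsPWIT {Ω : Type*} [MeasurableSpace Ω] (ξ : List ℕ → ℕ → Ω → ℝ) (μ : Measure Ω) :
    Prop where
  poisson : ∀ v, IsUnitPoissonProcess (ξ v) μ
  indep : iIndepFun (fun (v : List ℕ) ω (i : ℕ) => ξ v i ω) μ

/-- The law of the process `(ξ, X)` on a Poisson weighted infinite tree, where `X u v` is the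
variable on the directed edge `(u, v)` (only the values at adjacent `u`, `v` are used). The last
three fields say that, for every `d`, the variables on the edges from depth `d` to depth `d + 1`
are independent, have distribution `F_*`, and are jointly independent of the lengths of the edges
between vertices of depth at most `d + 1`. All other variables up to depth `d + 1` are functions
of these through `recursion`. -/
structure IsTreeProcess {Ω : Type*} [MeasurableSpace Ω] (ξ : List ℕ → ℕ → Ω → ℝ)
    (X : List ℕ → List ℕ → Ω → ℝ) (μ : Measure Ω) : Prop where
  pwit : IsPWIT ξ μ
  recursion : ∀ᵐ ω ∂μ, ∀ u v, tree.Adj u v →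
    IsLeast {r : ℝ | ∃ w, tree.Adj v w ∧ w ≠ u ∧
      r = max (edgeLength (fun a i => ξ a i ω) v w - X v w ω) 0} (X u v ω)
  law : ∀ v i, HasFStarLaw (X v (i :: v)) μ
  indep_level : ∀ d : ℕ,
    iIndepFun (fun (e : {v : List ℕ // v.length = d} × ℕ) ω => X e.1 (e.2 :: e.1) ω) μ
  indep_length : ∀ d : ℕ,
    IndepFun (fun ω (e : {v : List ℕ // v.length = d} × ℕ) => X e.1 (e.2 :: e.1) ω)
      (fun ω (e : {v : List ℕ // v.length ≤ d} × ℕ) => ξ e.1 e.2 ω) μ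

/-- `C_opt(v)`: the set of neighbours `y` of `v` that minimise `(ξ(v, y) - X(v, y))⁺`. -/
def optCover (ξ : List ℕ → ℕ → ℝ) (X : List ℕ → List ℕ → ℝ) (v : List ℕ) : Set (List ℕ) :=
  {y | y ∈ tree.neighborSet v ∧
    IsMinOn (fun w => max (edgeLength ξ v w - X v w) 0) (tree.neighborSet v) y}

/-- The total length of the edges joining the root to the vertices of `C_opt(root)`. -/
noncomputable def rootCost (ξ : List ℕ → ℕ → ℝ) (X : List ℕ → List ℕ → ℝ) : ENNReal :=
  ∑' v : optCover ξ X [], ENNReal.ofReal (edgeLength ξ [] v)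

end PWIT

/-!
Only the edges at the root matter. Their lengths `T 0 < T 1 < ⋯` form a unit Poisson process, and
the variables `X` on them are independent marks of law `F_*`, independent of the lengths. So the
cost at the root is the sum of `T i` over the indices `i` that minimise `(T i - X i)⁺`, a
functional of a marked Poisson process (`rootCost_eq_minimiserCost`, `IsTreeProcess.hasLaw_root`).

Mecke's formula (`lintegral_markedGapLaw_arrival`) turns the expectation of such a sum into
`∫ x dx ∫ F_*(du) P(every j has (T j - X j)⁺ ≥ (x - u)⁺)` (`lintegral_minimiserCost`). Here it is
proved for the `i`-th point by induction on `i`, the first gap being split off, and summed over `i`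
afterwards: the intervals between consecutive points partition the half-line.

It remains to find the probability that all points satisfy `X j ≤ s + T j`. Restricted to the
first `n` points it obeys a renewal recursion in `n`, which `exp (-W(1) e⁻ˢ)` satisfies exactly,
and for `s ≥ 0` the error is at most `e⁻ˢ 2⁻ⁿ` by induction (`markedGapLaw_marksBelow_bounds`). One
more step of the recursion gives `P(every j has (T j - X j)⁺ ≥ r) = W(1) e⁻ʳ` for `r > 0`, because
`exp (-W(1)) = W(1)`. What is left is the integral of
`x e⁻ˣ (2 W(1) - W(1)² + W(1)² x)` over the half-line, which is `2 W(1) + W(1)²`.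
-/

namespace PWIT

open Set
open scoped ENNReal

/-! ### Sequences with a prepended term -/

/-- The sequence `a, p 0, p 1, …`. -/
def consSeq (a : ℝ) (p : ℕ → ℝ) : ℕ → ℝ
  | 0 => a
  | n + 1 => p n

@[simp] theorem consSeq_zero (a : ℝ) (p : ℕ → ℝ) : consSeq a p 0 = a := rfl

@[simp] theorem consSeq_succ (a : ℝ) (p : ℕ → ℝ) (n : ℕ) : consSeq a p (n + 1) = p n := rfl

@[fun_prop]
theorem measurable_consSeq {α : Type*} [MeasurableSpace α] {f : α → ℝ} {g : α → ℕ → ℝ}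
    (hf : Measurable f) (hg : Measurable g) : Measurable fun x => consSeq (f x) (g x) := by
  refine measurable_pi_iff.2 fun n => ?_
  cases n with
  | zero => exact hf
  | succ n => exact measurable_pi_iff.1 hg n

theorem map_consSeq_prod_infinitePi (ν : Measure ℝ) [IsProbabilityMeasure ν] :
    (ν.prod (Measure.infinitePi fun _ : ℕ => ν)).map (fun x => consSeq x.1 x.2) =
      Measure.infinitePi fun _ : ℕ => ν := by
  refine Measure.eq_infinitePi _ fun s t ht => ?_
  classical
  -- Enlarging the index set to an initial segment makes the product split off its first factor.
  obtain ⟨n, hn⟩ : ∃ n, s ⊆ Finset.range (n + 1) :=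
    ⟨s.sup id, fun i hi => Finset.mem_range_succ_iff.2 (Finset.le_sup (f := id) hi)⟩
  set t' : ℕ → Set ℝ := fun i => if i ∈ s then t i else univ with ht'
  have ht'm : ∀ i, MeasurableSet (t' i) := fun i => by
    by_cases hi : i ∈ s <;> simp [ht', hi, ht i]
  have hset : (fun x : ℝ × (ℕ → ℝ) => consSeq x.1 x.2) ⁻¹' (Set.pi s t) =
      t' 0 ×ˢ Set.pi (Finset.range n) (fun i => t' (i + 1)) := by
    ext ⟨a, p⟩
    simp only [mem_preimage, Set.mem_pi, mem_prod, Finset.mem_coe, Finset.mem_range, ht']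
    constructor
    · intro h
      refine ⟨?_, fun i _ => ?_⟩
      · split_ifs with h0
        · exact h 0 h0
        · trivial
      · split_ifs with h0
        · exact h (i + 1) h0
        · trivial
    · rintro ⟨h0, h1⟩ i hi
      cases i with
      | zero => simpa [hi] using h0
      | succ i =>
        have := Finset.mem_range.1 (hn hi)
        simpa [hi] using h1 i (by omega)
  rw [Measure.map_apply (by fun_prop) (MeasurableSet.pi s.countable_toSet fun i _ => ht i), hset,
    Measure.prod_prod, Measure.infinitePi_pi _ (fun i _ => ht'm _), mul_comm,
    ← Finset.prod_range_succ' (fun i => ν (t' i)), ← Finset.prod_subset hn]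
  · exact Finset.prod_congr rfl fun i hi => by simp [ht', hi]
  · intro i _ hi
    simp [ht', hi]

theorem lintegral_infinitePi_eq_consSeq (ν : Measure ℝ) [IsProbabilityMeasure ν]
    {f : (ℕ → ℝ) → ℝ≥0∞} (hf : Measurable f) :
    ∫⁻ p, f p ∂(Measure.infinitePi fun _ : ℕ => ν) =
      ∫⁻ a, ∫⁻ p, f (consSeq a p) ∂(Measure.infinitePi fun _ : ℕ => ν) ∂ν := by
  have h : Measurable fun x : ℝ × (ℕ → ℝ) => f (consSeq x.1 x.2) := by fun_prop
  rw [← lintegral_prod _ h.aemeasurable, ← map_consSeq_prod_infinitePi ν,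
    lintegral_map hf (by fun_prop), map_consSeq_prod_infinitePi ν]

/-! ### Marked unit Poisson processes on the half-line -/

instance isProbabilityMeasure_expMeasure_one : IsProbabilityMeasure (expMeasure 1) :=
  isProbabilityMeasure_expMeasure one_pos

theorem lintegral_expMeasure_one {f : ℝ → ℝ≥0∞} (hf : Measurable f) :
    ∫⁻ x, f x ∂expMeasure 1 = ∫⁻ x in Ioi 0, ENNReal.ofReal (Real.exp (-x)) * f x := by
  have h1 : expMeasure 1 = volume.withDensity (exponentialPDF 1) := rfl
  have h2 : Measurable (exponentialPDF 1) := (measurable_exponentialPDFReal 1).ennreal_ofReal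
  rw [h1, lintegral_withDensity_eq_lintegral_mul _ h2 hf, ← setLIntegral_congr Ioi_ae_eq_Ici.symm,
    ← lintegral_indicator measurableSet_Ici]
  refine lintegral_congr fun x => ?_
  by_cases hx : 0 ≤ x
  · simp [exponentialPDF_of_nonneg hx, hx]
  · simp [exponentialPDF_of_neg (not_le.1 hx), hx]

/-- The law of the gaps and the marks of a unit Poisson process with independent marks of law
`F`. -/
noncomputable def markedGapLaw (F : Measure ℝ) : Measure ((ℕ → ℝ) × (ℕ → ℝ)) :=
  (Measure.infinitePi fun _ => expMeasure 1).prod (Measure.infinitePi fun _ => F)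

instance isProbabilityMeasure_markedGapLaw (F : Measure ℝ) [IsProbabilityMeasure F] :
    IsProbabilityMeasure (markedGapLaw F) := by
  unfold markedGapLaw; infer_instance

/-- Conditioning a marked Poisson process on its first gap and its first mark. -/
theorem lintegral_markedGapLaw (F : Measure ℝ) [IsProbabilityMeasure F]
    {f : (ℕ → ℝ) × (ℕ → ℝ) → ℝ≥0∞} (hf : Measurable f) :
    ∫⁻ z, f z ∂markedGapLaw F =
      ∫⁻ c, ∫⁻ z, f (consSeq c.1 z.1, consSeq c.2 z.2) ∂markedGapLaw F
        ∂(expMeasure 1).prod F := by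
  have hm' (a u : ℝ) : Measurable fun z : (ℕ → ℝ) × (ℕ → ℝ) =>
      f (consSeq a z.1, consSeq u z.2) := by fun_prop
  have hR : Measurable fun c : ℝ × ℝ =>
      ∫⁻ z, f (consSeq c.1 z.1, consSeq c.2 z.2) ∂markedGapLaw F := by
    refine Measurable.lintegral_prod_right'
      (f := fun x : (ℝ × ℝ) × ((ℕ → ℝ) × (ℕ → ℝ)) =>
        f (consSeq x.1.1 x.2.1, consSeq x.1.2 x.2.2)) ?_
    fun_prop
  have hL : Measurable fun p => ∫⁻ q, f (p, q) ∂Measure.infinitePi fun _ : ℕ => F :=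
    hf.lintegral_prod_right'
  rw [lintegral_prod _ hR.aemeasurable, markedGapLaw, lintegral_prod _ hf.aemeasurable,
    lintegral_infinitePi_eq_consSeq _ hL]
  refine lintegral_congr fun a => ?_
  simp_rw [lintegral_prod _ (hm' a _).aemeasurable]
  have hs : Measurable fun x : (ℕ → ℝ) × (ℕ → ℝ) => f (consSeq a x.1, x.2) := by fun_prop
  rw [lintegral_lintegral_swap hs.aemeasurable,
    lintegral_infinitePi_eq_consSeq F hs.lintegral_prod_left']
  refine lintegral_congr fun u => ?_
  exact lintegral_lintegral_swap ((hm' a u).comp measurable_swap).aemeasurable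

/-- The position of the `n`-th partial sum of the gaps `p`: `0` for `n = 0`, and the `n`-th point
of the process, counted from `1`, otherwise. -/
def partialSum (p : ℕ → ℝ) (n : ℕ) : ℝ := ∑ k ∈ Finset.range n, p k

/-- The points of the process with gaps `p`, numbered from `0`. -/
def arrival (p : ℕ → ℝ) (n : ℕ) : ℝ := partialSum p (n + 1)

theorem partialSum_consSeq (a : ℝ) (p : ℕ → ℝ) (n : ℕ) :
    partialSum (consSeq a p) (n + 1) = a + partialSum p n := by
  simp [partialSum, Finset.sum_range_succ', add_comm]

theorem arrival_consSeq (a : ℝ) (p : ℕ → ℝ) :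
    arrival (consSeq a p) = consSeq a fun n => a + arrival p n := by
  funext n
  cases n with
  | zero => simp [arrival, partialSum]
  | succ n => simp [arrival, partialSum_consSeq]

@[fun_prop]
theorem measurable_partialSum (n : ℕ) : Measurable fun p => partialSum p n := by
  unfold partialSum; fun_prop

@[fun_prop]
theorem measurable_arrival : Measurable arrival :=
  measurable_pi_iff.2 fun n => measurable_partialSum (n + 1)

/-- The sequence `t` with its `i`-th term removed. -/
def dropAt (i : ℕ) (t : ℕ → ℝ) (j : ℕ) : ℝ := if j < i then t j else t (j + 1)

theorem dropAt_zero_consSeq (a : ℝ) (t : ℕ → ℝ) : dropAt 0 (consSeq a t) = t := by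
  funext j; simp [dropAt]

theorem dropAt_succ_consSeq (i : ℕ) (a : ℝ) (t : ℕ → ℝ) :
    dropAt (i + 1) (consSeq a t) = consSeq a (dropAt i t) := by
  funext j
  cases j <;> simp [dropAt]

theorem add_dropAt (i : ℕ) (a : ℝ) (t : ℕ → ℝ) :
    (dropAt i fun n => a + t n) = fun n => a + dropAt i t n := by
  funext j; simp only [dropAt]; split_ifs <;> rfl

@[fun_prop]
theorem measurable_dropAt (i : ℕ) : Measurable (dropAt i) := by
  refine measurable_pi_iff.2 fun j => ?_
  unfold dropAt
  split_ifs <;> fun_prop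

/-! ### The Mecke formula -/

/-- The indicator of the event that `x` lies between the `i`-th partial sum of the gaps `p` and
the next one. -/
noncomputable def gapIndicator (i : ℕ) (p : ℕ → ℝ) (x : ℝ) : ℝ≥0∞ :=
  if partialSum p i ≤ x ∧ x < partialSum p (i + 1) then 1 else 0

@[fun_prop]
theorem measurable_gapIndicator {α : Type*} [MeasurableSpace α] (i : ℕ) {g : α → ℕ → ℝ}
    {f : α → ℝ} (hg : Measurable g) (hf : Measurable f) :
    Measurable fun x => gapIndicator i (g x) (f x) := by
  unfold gapIndicator
  refine Measurable.ite (MeasurableSet.inter ?_ ?_) measurable_const measurable_const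
  · exact measurableSet_le (by fun_prop) hf
  · exact measurableSet_lt hf (by fun_prop)

theorem gapIndicator_succ_consSeq (i : ℕ) (a : ℝ) (p : ℕ → ℝ) (x : ℝ) :
    gapIndicator (i + 1) (consSeq a p) (a + x) = gapIndicator i p x := by
  simp [gapIndicator, partialSum_consSeq]

theorem lintegral_swap_of_measurable {α β : Type*} [MeasurableSpace α] [MeasurableSpace β]
    {μ : Measure α} {ν : Measure β} [SFinite μ] [SFinite ν] {g : α × β → ℝ≥0∞}
    (hg : Measurable g) : ∫⁻ x, ∫⁻ y, g (x, y) ∂ν ∂μ = ∫⁻ y, ∫⁻ x, g (x, y) ∂μ ∂ν :=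
  lintegral_lintegral_swap (f := fun x y => g (x, y)) hg.aemeasurable

/-- The points `a < a + b` with exponential gaps have the same law as the pair formed by a point
`x` chosen by Lebesgue measure and an exponential variable that exceeds it. -/
theorem lintegral_first_two_points {k : ℝ × ℝ → ℝ≥0∞} (hk : Measurable k) :
    ∫⁻ a, ∫⁻ b, k (a, a + b) ∂expMeasure 1 ∂expMeasure 1 =
      ∫⁻ x, ∫⁻ b, (if 0 ≤ x ∧ x < b then 1 else 0) * k (x, b) ∂expMeasure 1 := by
  have h1 : Measurable fun a => ∫⁻ b, k (a, a + b) ∂expMeasure 1 :=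
    Measurable.lintegral_prod_right' (f := fun x : ℝ × ℝ => k (x.1, x.1 + x.2)) (by fun_prop)
  rw [lintegral_expMeasure_one h1, ← lintegral_indicator measurableSet_Ioi]
  have h0 : ∀ᵐ x : ℝ, x ≠ 0 := Measure.ae_ne volume 0
  refine lintegral_congr_ae ?_
  filter_upwards [h0] with x hx0
  rcases lt_or_gt_of_ne hx0 with hx | hx
  · simp [hx.not_ge, hx.not_gt]
  have h2 : Measurable fun b : ℝ => (if 0 ≤ x ∧ x < b then (1 : ℝ≥0∞) else 0) * k (x, b) := by
    refine Measurable.mul (Measurable.ite ?_ measurable_const measurable_const) (by fun_prop)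
    exact MeasurableSet.inter (MeasurableSet.const _) measurableSet_Ioi
  rw [indicator_of_mem (mem_Ioi.2 hx), lintegral_expMeasure_one (by fun_prop),
    lintegral_expMeasure_one h2, ← lintegral_const_mul _ (by fun_prop),
    ← lintegral_indicator measurableSet_Ioi, ← lintegral_indicator measurableSet_Ioi]
  refine Eq.trans (lintegral_congr fun b => ?_) (lintegral_add_left_eq_self _ x)
  by_cases hb : 0 < b
  · have hb' : 0 < x + b := by linarith
    simp only [indicator, mem_Ioi, hb, hb', hx.le, if_true, true_and, one_mul,
      lt_add_iff_pos_right, ← mul_assoc]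
    rw [← ENNReal.ofReal_mul (Real.exp_nonneg _), ← Real.exp_add]
    congr 3
    ring
  · simp [indicator, hb]

/-- Integration over two pairs, regrouped into first and second components. -/
theorem lintegral_prod_prod_comm {ν₁ ν₂ F : Measure ℝ} [SFinite ν₁] [SFinite ν₂] [SFinite F]
    {g : (ℝ × ℝ) × (ℝ × ℝ) → ℝ≥0∞} (hg : Measurable g) :
    ∫⁻ c, ∫⁻ d, g (c, d) ∂ν₂.prod F ∂ν₁.prod F =
      ∫⁻ a, ∫⁻ b, ∫⁻ e, g ((a, e.1), (b, e.2)) ∂F.prod F ∂ν₂ ∂ν₁ := by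
  rw [lintegral_prod _ hg.lintegral_prod_right'.aemeasurable]
  refine lintegral_congr fun a => ?_
  have h1 : Measurable fun x : ℝ × ℝ => ∫⁻ v, g ((a, x.2), (x.1, v)) ∂F :=
    Measurable.lintegral_prod_right'
      (f := fun y : (ℝ × ℝ) × ℝ => g ((a, y.1.2), (y.1.1, y.2))) (by fun_prop)
  have h2 (u : ℝ) : Measurable fun d : ℝ × ℝ => g ((a, u), d) := by fun_prop
  have h3 (b : ℝ) : Measurable fun e : ℝ × ℝ => g ((a, e.1), (b, e.2)) := by fun_prop
  simp_rw [lintegral_prod _ (h2 _).aemeasurable, lintegral_prod _ (h3 _).aemeasurable]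
  exact (lintegral_lintegral_swap h1.aemeasurable).symm

/-- Mecke's formula for the `i`-th point: a functional of the `i`-th marked point and of the
process formed by the others has the same integral as if a point were added at random, by Lebesgue
measure, between the partial sums of index `i` and `i + 1`. The induction on `i` removes the first
point; the first two points carry the case `i = 0`. -/
theorem lintegral_markedGapLaw_arrival (F : Measure ℝ) [IsProbabilityMeasure F] (i : ℕ)
    {f : (ℝ × ℝ) × ((ℕ → ℝ) × (ℕ → ℝ)) → ℝ≥0∞} (hf : Measurable f) :
    ∫⁻ z, f ((arrival z.1 i, z.2 i), (dropAt i (arrival z.1), dropAt i z.2)) ∂markedGapLaw F =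
      ∫⁻ y, ∫⁻ z, gapIndicator i z.1 y.1 * f (y, (arrival z.1, z.2)) ∂markedGapLaw F
        ∂volume.prod F := by
  induction i generalizing f with
  | zero =>
    have hA : Measurable fun z : (ℕ → ℝ) × (ℕ → ℝ) =>
        f ((arrival z.1 0, z.2 0), (dropAt 0 (arrival z.1), dropAt 0 z.2)) := by fun_prop
    rw [lintegral_markedGapLaw F hA]
    have hB (c : ℝ × ℝ) : Measurable fun z : (ℕ → ℝ) × (ℕ → ℝ) =>
        f (c, ((fun n => c.1 + arrival z.1 n), z.2)) := by fun_prop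
    have hC (y : ℝ × ℝ) : Measurable fun z : (ℕ → ℝ) × (ℕ → ℝ) =>
        gapIndicator 0 z.1 y.1 * f (y, (arrival z.1, z.2)) := by fun_prop
    simp only [arrival_consSeq, consSeq_zero, dropAt_zero_consSeq]
    have hk : Measurable fun x : ℝ × ℝ => ∫⁻ e, ∫⁻ z, f ((x.1, e.1),
        (consSeq x.2 fun n => x.2 + arrival z.1 n, consSeq e.2 z.2))
        ∂markedGapLaw F ∂F.prod F := by
      refine Measurable.lintegral_prod_right' (f := fun y : (ℝ × ℝ) × (ℝ × ℝ) =>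
        ∫⁻ z, f ((y.1.1, y.2.1), (consSeq y.1.2 fun n => y.1.2 + arrival z.1 n,
          consSeq y.2.2 z.2)) ∂markedGapLaw F) ?_
      refine Measurable.lintegral_prod_right' (f := fun y : ((ℝ × ℝ) × (ℝ × ℝ)) ×
        ((ℕ → ℝ) × (ℕ → ℝ)) => f ((y.1.1.1, y.1.2.1), (consSeq y.1.1.2 fun n =>
          y.1.1.2 + arrival y.2.1 n, consSeq y.1.2.2 y.2.2))) ?_
      fun_prop
    have key := lintegral_first_two_points hk
    simp_rw [lintegral_markedGapLaw F (hB _), lintegral_markedGapLaw F (hC _)]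
    rw [lintegral_prod_prod_comm (g := fun y : (ℝ × ℝ) × (ℝ × ℝ) =>
        ∫⁻ z, f (y.1, ((fun n => y.1.1 + arrival (consSeq y.2.1 z.1) n), consSeq y.2.2 z.2))
          ∂markedGapLaw F) ?_,
      lintegral_prod_prod_comm (g := fun y : (ℝ × ℝ) × (ℝ × ℝ) =>
        ∫⁻ z, gapIndicator 0 (consSeq y.2.1 z.1) y.1.1 *
          f (y.1, (arrival (consSeq y.2.1 z.1), consSeq y.2.2 z.2)) ∂markedGapLaw F) ?_]
    · convert key using 1
      · refine lintegral_congr fun a => lintegral_congr fun b => lintegral_congr fun e =>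
          lintegral_congr fun z => ?_
        congr 3
        funext n
        rw [arrival_consSeq]
        cases n <;> simp [add_assoc]
      · refine lintegral_congr fun x => lintegral_congr fun b => ?_
        have h01 (p : ℕ → ℝ) : gapIndicator 0 (consSeq b p) x =
            if 0 ≤ x ∧ x < b then 1 else 0 := by
          simp [gapIndicator, partialSum]
        simp_rw [h01, arrival_consSeq]
        split_ifs <;> simp
    · refine Measurable.lintegral_prod_right' (f := fun y : ((ℝ × ℝ) × (ℝ × ℝ)) ×
        ((ℕ → ℝ) × (ℕ → ℝ)) => gapIndicator 0 (consSeq y.1.2.1 y.2.1) y.1.1.1 *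
          f (y.1.1, (arrival (consSeq y.1.2.1 y.2.1), consSeq y.1.2.2 y.2.2))) ?_
      fun_prop
    · refine Measurable.lintegral_prod_right' (f := fun y : ((ℝ × ℝ) × (ℝ × ℝ)) ×
        ((ℕ → ℝ) × (ℕ → ℝ)) => f (y.1.1, ((fun n => y.1.1.1 +
          arrival (consSeq y.1.2.1 y.2.1) n), consSeq y.1.2.2 y.2.2))) ?_
      fun_prop
  | succ i ih =>
    have hA : Measurable fun z : (ℕ → ℝ) × (ℕ → ℝ) => f ((arrival z.1 (i + 1), z.2 (i + 1)),
        (dropAt (i + 1) (arrival z.1), dropAt (i + 1) z.2)) := by fun_prop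
    have hC (y : ℝ × ℝ) : Measurable fun z : (ℕ → ℝ) × (ℕ → ℝ) =>
        gapIndicator (i + 1) z.1 y.1 * f (y, (arrival z.1, z.2)) := by fun_prop
    have hD (c : ℝ × ℝ) : Measurable fun y : (ℝ × ℝ) × ((ℕ → ℝ) × (ℕ → ℝ)) =>
        f ((c.1 + y.1.1, y.1.2), (consSeq c.1 (fun n => c.1 + y.2.1 n), consSeq c.2 y.2.2)) := by
      fun_prop
    rw [lintegral_markedGapLaw F hA]
    simp_rw [lintegral_markedGapLaw F (hC _)]
    have hG : Measurable fun x : (ℝ × ℝ) × (ℝ × ℝ) =>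
        ∫⁻ z, gapIndicator (i + 1) (consSeq x.2.1 z.1) x.1.1 *
          f (x.1, (arrival (consSeq x.2.1 z.1), consSeq x.2.2 z.2)) ∂markedGapLaw F := by
      refine Measurable.lintegral_prod_right' (f := fun y : ((ℝ × ℝ) × (ℝ × ℝ)) ×
        ((ℕ → ℝ) × (ℕ → ℝ)) => gapIndicator (i + 1) (consSeq y.1.2.1 y.2.1) y.1.1.1 *
          f (y.1.1, (arrival (consSeq y.1.2.1 y.2.1), consSeq y.1.2.2 y.2.2))) ?_
      fun_prop
    rw [lintegral_swap_of_measurable hG]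
    refine lintegral_congr fun c => ?_
    have hi := ih (hD c)
    simp only [arrival_consSeq, consSeq_succ, dropAt_succ_consSeq, add_dropAt] at hi ⊢
    rw [hi]
    have hG' : Measurable fun y : ℝ × ℝ =>
        ∫⁻ z, gapIndicator (i + 1) (consSeq c.1 z.1) y.1 *
          f (y, (consSeq c.1 (fun n => c.1 + arrival z.1 n), consSeq c.2 z.2))
          ∂markedGapLaw F := by
      refine Measurable.lintegral_prod_right' (f := fun y : (ℝ × ℝ) ×
        ((ℕ → ℝ) × (ℕ → ℝ)) => gapIndicator (i + 1) (consSeq c.1 y.2.1) y.1.1 *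
          f (y.1, (consSeq c.1 (fun n => c.1 + arrival y.2.1 n), consSeq c.2 y.2.2))) ?_
      fun_prop
    have hs : Measurable fun y : ℝ × ℝ => (c.1 + y.1, y.2) := by fun_prop
    rw [lintegral_prod_symm _ hG'.aemeasurable]
    have hG'' := hG'.comp hs
    simp only [Function.comp_def] at hG''
    have hshift := lintegral_prod_symm (μ := volume) (ν := F) _ hG''.aemeasurable
    simp only [gapIndicator_succ_consSeq] at hshift
    rw [hshift]
    refine lintegral_congr fun u => ?_
    refine Eq.trans ?_ (lintegral_add_left_eq_self _ c.1)
    simp only [gapIndicator_succ_consSeq]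

/-! ### The points exhaust the half-line -/

theorem ae_gap_pos (F : Measure ℝ) [IsProbabilityMeasure F] :
    ∀ᵐ z ∂markedGapLaw F, ∀ k, 0 < z.1 k := by
  refine ae_all_iff.2 fun k => ?_
  have h : ∀ᵐ x ∂expMeasure 1, 0 < x := by
    have h0 : ∫⁻ x, (Iic 0).indicator 1 x ∂expMeasure 1 = 0 := by
      rw [lintegral_expMeasure_one (measurable_one.indicator measurableSet_Iic)]
      refine (setLIntegral_congr_fun measurableSet_Ioi fun x hx => ?_).trans lintegral_zero
      simp [mem_Ioi.1 hx]
    rw [lintegral_indicator_one measurableSet_Iic] at h0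
    exact ae_iff.2 (by simp only [not_lt]; exact h0)
  exact ((measurePreserving_eval_infinitePi (fun _ : ℕ => expMeasure 1) k).comp
    measurePreserving_fst).quasiMeasurePreserving.ae h

/-- The fundamental theorem of calculus on a half-line, for a nonnegative derivative and the lower
Lebesgue integral. -/
theorem lintegral_Ioi_of_hasDerivAt {g g' : ℝ → ℝ} {a l : ℝ} (hg : ∀ x, HasDerivAt g (g' x) x)
    (hpos : ∀ x ∈ Ioi a, 0 ≤ g' x) (hl : Filter.Tendsto g Filter.atTop (nhds l)) :
    ∫⁻ x in Ioi a, ENNReal.ofReal (g' x) = ENNReal.ofReal (l - g a) := by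
  rw [← integral_Ioi_of_hasDerivAt_of_nonneg' (fun x _ => hg x) hpos hl,
    ofReal_integral_eq_lintegral_ofReal
      (integrableOn_Ioi_deriv_of_nonneg' (fun x _ => hg x) hpos hl)]
  exact (ae_restrict_iff' measurableSet_Ioi).2 (ae_of_all _ hpos)

theorem lintegral_exp_neg_expMeasure_one :
    ∫⁻ a, ENNReal.ofReal (Real.exp (-a)) ∂expMeasure 1 = 2⁻¹ := by
  rw [lintegral_expMeasure_one (by fun_prop)]
  have h : ∀ x, HasDerivAt (fun x : ℝ => -(Real.exp (-x) * Real.exp (-x)) / 2)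
      (Real.exp (-x) * Real.exp (-x)) x := fun x => by
    have h1 : HasDerivAt (fun x : ℝ => Real.exp (-x)) (-Real.exp (-x)) x := by
      simpa using (hasDerivAt_neg x).exp
    convert! ((h1.mul h1).neg.div_const 2) using 1
    ring
  have := lintegral_Ioi_of_hasDerivAt (a := 0) (l := 0) h (fun x _ => by positivity)
    (by simpa using (Real.tendsto_exp_neg_atTop_nhds_zero.mul
      Real.tendsto_exp_neg_atTop_nhds_zero).neg.div_const 2)
  simp_rw [← ENNReal.ofReal_mul (Real.exp_nonneg _)]
  rw [this]
  simp only [neg_zero, Real.exp_zero]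
  rw [← ENNReal.ofReal_ofNat, ← ENNReal.ofReal_inv_of_pos (by norm_num)]
  norm_num

theorem lintegral_exp_neg_partialSum (F : Measure ℝ) [IsProbabilityMeasure F] (n : ℕ) :
    ∫⁻ z, ENNReal.ofReal (Real.exp (-partialSum z.1 n)) ∂markedGapLaw F = 2⁻¹ ^ n := by
  induction n with
  | zero => simp [partialSum]
  | succ n ih =>
    rw [lintegral_markedGapLaw F (by fun_prop)]
    simp only [partialSum_consSeq, neg_add, Real.exp_add, ENNReal.ofReal_mul (Real.exp_nonneg _)]
    have (c : ℝ × ℝ) : ∫⁻ z, ENNReal.ofReal (Real.exp (-c.1)) *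
        ENNReal.ofReal (Real.exp (-partialSum z.1 n)) ∂markedGapLaw F =
          ENNReal.ofReal (Real.exp (-c.1)) * 2⁻¹ ^ n := by
      rw [lintegral_const_mul _ (by fun_prop), ih]
    simp_rw [this]
    rw [lintegral_mul_const _ (by fun_prop), lintegral_prod _ (by fun_prop)]
    simp [lintegral_exp_neg_expMeasure_one, pow_succ']

/-- The points of the process are almost surely unbounded. -/
theorem ae_exists_lt_partialSum (F : Measure ℝ) [IsProbabilityMeasure F] (x : ℝ) :
    ∀ᵐ z ∂markedGapLaw F, ∃ n, x < partialSum z.1 n := by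
  rw [ae_iff]
  -- Markov's inequality for `exp (x - partialSum z.1 n)`, whose mean is `exp x * 2⁻ⁿ`.
  have hb (n : ℕ) : markedGapLaw F {z | ¬∃ n, x < partialSum z.1 n} ≤
      ENNReal.ofReal (Real.exp x) * 2⁻¹ ^ n := by
    rw [← lintegral_exp_neg_partialSum F n, ← lintegral_const_mul _ (by fun_prop)]
    refine (measure_mono fun z hz => ?_).trans
      ((mul_one _).symm.trans_le (mul_comm _ (1 : ℝ≥0∞) |>.trans_le
        (mul_meas_ge_le_lintegral (by fun_prop) 1)))
    simp only [mem_ofPred_eq, not_exists, not_lt] at hz ⊢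
    rw [← ENNReal.ofReal_mul (Real.exp_nonneg _), ← Real.exp_add, ← ENNReal.ofReal_one]
    exact ENNReal.ofReal_le_ofReal (Real.one_le_exp (by linarith [hz n]))
  have ht : Filter.Tendsto (fun n : ℕ => ENNReal.ofReal (Real.exp x) * 2⁻¹ ^ n)
      Filter.atTop (nhds 0) := by
    have := ENNReal.Tendsto.const_mul (a := ENNReal.ofReal (Real.exp x))
      (ENNReal.tendsto_pow_atTop_nhds_zero_of_lt_one (r := 2⁻¹)
        (ENNReal.inv_lt_one.2 (by norm_num))) (Or.inr ENNReal.ofReal_ne_top)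
    simpa using this
  exact le_antisymm (ge_of_tendsto' ht hb) bot_le

theorem partialSum_mono {p : ℕ → ℝ} (hp : ∀ k, 0 < p k) : Monotone (partialSum p) :=
  monotone_nat_of_le_succ fun n => by simp [partialSum, Finset.sum_range_succ, (hp n).le]

theorem tsum_gapIndicator {p : ℕ → ℝ} (hp : ∀ k, 0 < p k) {x : ℝ}
    (hx : ∃ n, x < partialSum p n) : ∑' i, gapIndicator i p x = if 0 ≤ x then 1 else 0 := by
  classical
  have hm := partialSum_mono hp
  have h0 : partialSum p 0 = 0 := by simp [partialSum]
  split_ifs with h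
  · obtain ⟨i, hi⟩ : ∃ i, Nat.find hx = i + 1 :=
      Nat.exists_eq_succ_of_ne_zero fun h' => by
        have := Nat.find_spec hx
        rw [h', h0] at this
        linarith
    have h1 : x < partialSum p (i + 1) := hi ▸ Nat.find_spec hx
    have h2 : partialSum p i ≤ x := not_lt.1 (Nat.find_min hx (by omega))
    rw [tsum_eq_single i fun j hj => ?_]
    · simp [gapIndicator, h1, h2]
    · refine if_neg fun ⟨h3, h4⟩ => ?_
      rcases lt_or_gt_of_ne hj with hj | hj
      · exact absurd (h4.trans_le (hm hj)) h2.not_gt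
      · exact absurd (h1.trans_le (hm hj)) h3.not_gt
  · refine ENNReal.tsum_eq_zero.2 fun i => if_neg fun h' => h ?_
    exact (h0 ▸ hm (Nat.zero_le i)).trans h'.1

/-! ### The cost of the minimisers -/

/-- The sum of the positions `t i` over the indices `i` that minimise `(t i - q i)⁺`. -/
noncomputable def minimiserCost (t q : ℕ → ℝ) : ℝ≥0∞ :=
  open Classical in
  ∑' i, if ∀ j, max (t i - q i) 0 ≤ max (t j - q j) 0 then ENNReal.ofReal (t i) else 0

theorem measurable_minimiserCost :
    Measurable fun z : (ℕ → ℝ) × (ℕ → ℝ) => minimiserCost z.1 z.2 := by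
  classical
  refine Measurable.tsum fun i => Measurable.ite ?_ (by fun_prop) measurable_const
  exact measurableSet_setOfPred.2 (Measurable.forall fun j =>
    measurableSet_setOfPred.1 (measurableSet_le (by fun_prop) (by fun_prop)))

/-- The event that every point of the process has `(t j - q j)⁺ ≥ max r 0`. -/
def allAbove (r : ℝ) : Set ((ℕ → ℝ) × (ℕ → ℝ)) :=
  {z | ∀ j, max r 0 ≤ max (arrival z.1 j - z.2 j) 0}

theorem measurableSet_allAbove :
    MeasurableSet {y : ℝ × ((ℕ → ℝ) × (ℕ → ℝ)) | y.2 ∈ allAbove y.1} :=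
  measurableSet_setOfPred.2 (Measurable.forall fun j =>
    measurableSet_setOfPred.1 (measurableSet_le (by fun_prop) (by fun_prop)))

/-- Mecke's formula for the cost of the minimisers: a point at `x` with mark `u` is a minimiser if
and only if `(t j - q j)⁺ ≥ (x - u)⁺` at all points of the remaining process. -/
theorem lintegral_minimiserCost (F : Measure ℝ) [IsProbabilityMeasure F] :
    ∫⁻ z, minimiserCost (arrival z.1) z.2 ∂markedGapLaw F =
      ∫⁻ x in Ioi 0, ENNReal.ofReal x * ∫⁻ u, markedGapLaw F (allAbove (x - u)) ∂F := by
  classical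
  set f : (ℝ × ℝ) × ((ℕ → ℝ) × (ℕ → ℝ)) → ℝ≥0∞ := fun y =>
    if ∀ j, max (y.1.1 - y.1.2) 0 ≤ max (y.2.1 j - y.2.2 j) 0 then ENNReal.ofReal y.1.1 else 0
    with hf
  have hfm : Measurable f := by
    refine Measurable.ite ?_ (by fun_prop) measurable_const
    exact measurableSet_setOfPred.2 (Measurable.forall fun j =>
      measurableSet_setOfPred.1 (measurableSet_le (by fun_prop) (by fun_prop)))
  -- Comparing the `i`-th point with all points or with all others is the same.
  have hfi (i : ℕ) (z : (ℕ → ℝ) × (ℕ → ℝ)) :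
      (if ∀ j, max (arrival z.1 i - z.2 i) 0 ≤ max (arrival z.1 j - z.2 j) 0
        then ENNReal.ofReal (arrival z.1 i) else 0) =
      f ((arrival z.1 i, z.2 i), (dropAt i (arrival z.1), dropAt i z.2)) := by
    simp only [hf]
    refine if_congr ⟨fun h j => ?_, fun h j => ?_⟩ rfl rfl
    · simp only [dropAt]; split_ifs <;> exact h _
    · rcases lt_trichotomy j i with hj | rfl | hj
      · simpa [dropAt, hj] using h j
      · exact le_rfl
      · obtain ⟨k, rfl⟩ : ∃ k, j = k + 1 := ⟨j - 1, by omega⟩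
        simpa [dropAt, show ¬k < i by omega] using h k
  have hfm' (i : ℕ) : Measurable fun z : (ℕ → ℝ) × (ℕ → ℝ) =>
      f ((arrival z.1 i, z.2 i), (dropAt i (arrival z.1), dropAt i z.2)) := by fun_prop
  have hgm (i : ℕ) : Measurable fun y : (ℝ × ℝ) × ((ℕ → ℝ) × (ℕ → ℝ)) =>
      gapIndicator i y.2.1 y.1.1 * f (y.1, (arrival y.2.1, y.2.2)) := by fun_prop
  simp only [minimiserCost, hfi]
  rw [lintegral_tsum fun i => (hfm' i).aemeasurable]
  simp_rw [lintegral_markedGapLaw_arrival F _ hfm]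
  rw [← lintegral_tsum fun i => (hgm i).lintegral_prod_right'.aemeasurable]
  have hR : Measurable fun y : ℝ × ℝ => ENNReal.ofReal y.1 *
      markedGapLaw F (allAbove (y.1 - y.2)) := by
    refine Measurable.mul (by fun_prop) ?_
    have hs : MeasurableSet {y : (ℝ × ℝ) × ((ℕ → ℝ) × (ℕ → ℝ)) |
        y.2 ∈ allAbove (y.1.1 - y.1.2)} :=
      measurableSet_allAbove.preimage (f := fun y : (ℝ × ℝ) × ((ℕ → ℝ) × (ℕ → ℝ)) =>
        (y.1.1 - y.1.2, y.2)) (by fun_prop)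
    exact measurable_measure_prodMk_left hs
  have key (y : ℝ × ℝ) : ∑' i, ∫⁻ z, gapIndicator i z.1 y.1 *
      f (y, (arrival z.1, z.2)) ∂markedGapLaw F =
        ENNReal.ofReal y.1 * markedGapLaw F (allAbove (y.1 - y.2)) := by
    have hgy (i : ℕ) : Measurable fun z : (ℕ → ℝ) × (ℕ → ℝ) =>
        gapIndicator i z.1 y.1 * f (y, (arrival z.1, z.2)) := by fun_prop
    rw [← lintegral_tsum fun i => (hgy i).aemeasurable]
    have hs : MeasurableSet (allAbove (y.1 - y.2)) :=
      measurableSet_allAbove.preimage measurable_prodMk_left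
    rw [← lintegral_indicator_one hs, ← lintegral_const_mul _ (measurable_one.indicator hs)]
    refine lintegral_congr_ae ?_
    filter_upwards [ae_gap_pos F, ae_exists_lt_partialSum F y.1] with z h1 h2
    rw [ENNReal.tsum_mul_right, tsum_gapIndicator h1 h2]
    by_cases h0 : 0 ≤ y.1
    · simp [hf, h0, indicator, allAbove]
    · simp [h0, ENNReal.ofReal_of_nonpos (not_le.1 h0).le]
  simp_rw [key]
  rw [lintegral_prod _ hR.aemeasurable, ← lintegral_indicator measurableSet_Ioi]
  refine lintegral_congr fun x => ?_
  by_cases hx : 0 < x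
  · simp only [indicator, mem_Ioi, hx, if_true]
    exact lintegral_const_mul _ (measurable_measure_prodMk_left (measurableSet_allAbove.preimage
      (f := fun y : ℝ × ((ℕ → ℝ) × (ℕ → ℝ)) => (x - y.1, y.2)) (by fun_prop)))
  · simp [hx, ENNReal.ofReal_of_nonpos (not_lt.1 hx)]

/-! ### The law `F_*` as a measure -/

theorem lambertW_one_mul_exp : lambertW 1 * Real.exp (lambertW 1) = 1 ∧ 0 ≤ lambertW 1 := by
  have hex : ∃ a ∈ Set.Ici (0 : ℝ), (fun x : ℝ => x * Real.exp x) a = 1 := by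
    obtain ⟨a, ha, h⟩ := intermediate_value_Icc (f := fun x : ℝ => x * Real.exp x)
      (zero_le_one (α := ℝ)) (by fun_prop)
      (show (1 : ℝ) ∈ _ from ⟨by simp, by simp⟩)
    exact ⟨a, ha.1, h⟩
  exact ⟨Function.invFunOn_eq hex, Function.invFunOn_mem hex⟩

theorem lambertW_one_pos : 0 < lambertW 1 := by
  obtain ⟨h, h0⟩ := lambertW_one_mul_exp
  refine h0.lt_of_ne fun h' => ?_
  rw [← h'] at h
  simp at h

theorem lambertW_one_le_one : lambertW 1 ≤ 1 := by
  obtain ⟨h, h0⟩ := lambertW_one_mul_exp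
  nlinarith [Real.one_le_exp h0]

theorem exp_neg_lambertW_one : Real.exp (-lambertW 1) = lambertW 1 := by
  rw [Real.exp_neg]
  exact (eq_inv_of_mul_eq_one_left lambertW_one_mul_exp.1).symm

/-- The probability measure `F_*`: an atom of mass `1 - W(1)` at `0`, and the exponential law with
the remaining mass. -/
noncomputable def fStarMeasure : Measure ℝ :=
  ENNReal.ofReal (1 - lambertW 1) • Measure.dirac 0 + ENNReal.ofReal (lambertW 1) • expMeasure 1

instance isProbabilityMeasure_fStarMeasure : IsProbabilityMeasure fStarMeasure := by
  refine ⟨?_⟩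
  simp only [fStarMeasure, Measure.coe_add, Measure.coe_smul, Pi.add_apply, Pi.smul_apply,
    measure_univ, smul_eq_mul, mul_one]
  rw [← ENNReal.ofReal_add (by linarith [lambertW_one_le_one]) lambertW_one_pos.le]
  simp

theorem hasDerivAt_exp_neg (x : ℝ) :
    HasDerivAt (fun x : ℝ => Real.exp (-x)) (-Real.exp (-x)) x := by
  simpa using (hasDerivAt_neg x).exp

theorem lintegral_Ioi_exp_neg (s : ℝ) :
    ∫⁻ x in Ioi s, ENNReal.ofReal (Real.exp (-x)) = ENNReal.ofReal (Real.exp (-s)) := by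
  have h := lintegral_Ioi_of_hasDerivAt (a := s) (l := 0) (g := fun x => -Real.exp (-x))
    (g' := fun x => Real.exp (-x)) (fun x => by convert! (hasDerivAt_exp_neg x).neg using 1; simp)
    (fun x _ => by positivity) (by simpa using Real.tendsto_exp_neg_atTop_nhds_zero.neg)
  simpa using h

theorem expMeasure_one_Ioi {s : ℝ} (hs : 0 ≤ s) :
    expMeasure 1 (Ioi s) = ENNReal.ofReal (Real.exp (-s)) := by
  rw [← lintegral_indicator_one measurableSet_Ioi,
    lintegral_expMeasure_one (measurable_one.indicator measurableSet_Ioi),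
    ← lintegral_Ioi_exp_neg, ← lintegral_indicator measurableSet_Ioi,
    ← lintegral_indicator measurableSet_Ioi]
  refine lintegral_congr fun x => ?_
  by_cases hx : s < x
  · simp [hx, hs.trans_lt hx]
  · simp [hx]

theorem fStarMeasure_Ioi (s : ℝ) : fStarMeasure (Ioi s) = ENNReal.ofReal (fStarTail s) := by
  by_cases hs : 0 ≤ s
  · simp [fStarMeasure, fStarTail, hs, expMeasure_one_Ioi hs,
      ENNReal.ofReal_mul lambertW_one_pos.le]
  · have h1 : expMeasure 1 (Ioi s) = 1 := by
      have h0 := expMeasure_one_Ioi le_rfl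
      rw [neg_zero, Real.exp_zero, ENNReal.ofReal_one] at h0
      exact le_antisymm prob_le_one (h0 ▸ measure_mono (Ioi_subset_Ioi (not_le.1 hs).le))
    simp only [fStarMeasure, Measure.coe_add, Measure.coe_smul, Pi.add_apply, Pi.smul_apply, h1,
      fStarTail, hs, if_false, smul_eq_mul, mul_one]
    rw [Measure.dirac_apply_of_mem (mem_Ioi.2 (not_le.1 hs)), mul_one,
      ← ENNReal.ofReal_add (by linarith [lambertW_one_le_one]) lambertW_one_pos.le]
    simp

theorem fStarTail_nonneg (s : ℝ) : 0 ≤ fStarTail s := by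
  have := lambertW_one_pos
  unfold fStarTail; split_ifs <;> positivity

theorem fStarMeasure_Iic (s : ℝ) : fStarMeasure (Iic s) = ENNReal.ofReal (1 - fStarTail s) := by
  rw [← compl_Ioi, prob_compl_eq_one_sub measurableSet_Ioi, fStarMeasure_Ioi,
    ENNReal.ofReal_sub _ (fStarTail_nonneg s), ENNReal.ofReal_one]

theorem HasFStarLaw.hasLaw {Ω : Type*} [MeasurableSpace Ω] {Z : Ω → ℝ} {μ : Measure Ω}
    [IsProbabilityMeasure μ] (h : HasFStarLaw Z μ) : HasLaw Z fStarMeasure μ where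
  aemeasurable := h.1
  map_eq := by
    have := Measure.isProbabilityMeasure_map h.1
    refine Measure.ext_of_Iic _ _ fun a => ?_
    rw [← compl_Ioi, prob_compl_eq_one_sub measurableSet_Ioi,
      prob_compl_eq_one_sub measurableSet_Ioi, fStarMeasure_Ioi, ← h.2 a,
      Measure.map_apply_of_aemeasurable h.1 measurableSet_Ioi]
    rfl

theorem lintegral_fStarMeasure {f : ℝ → ℝ≥0∞} (hf : Measurable f) :
    ∫⁻ u, f u ∂fStarMeasure = ENNReal.ofReal (1 - lambertW 1) * f 0 +
      ENNReal.ofReal (lambertW 1) * ∫⁻ u in Ioi 0, ENNReal.ofReal (Real.exp (-u)) * f u := by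
  rw [fStarMeasure, lintegral_add_measure, lintegral_smul_measure, lintegral_smul_measure,
    lintegral_dirac' _ hf, lintegral_expMeasure_one hf]
  rfl

/-! ### Void probabilities -/

/-- The event that each of the first `n` points, shifted by `s`, is at least its mark. The case
`n = ⊤` concerns all points. -/
def marksBelow (n : ℕ∞) (s : ℝ) : Set ((ℕ → ℝ) × (ℕ → ℝ)) :=
  {z | ∀ j : ℕ, (j : ℕ∞) < n → z.2 j ≤ s + arrival z.1 j}

theorem measurableSet_marksBelow (n : ℕ∞) :
    MeasurableSet {y : ℝ × ((ℕ → ℝ) × (ℕ → ℝ)) | y.2 ∈ marksBelow n y.1} :=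
  measurableSet_setOfPred.2 (Measurable.forall fun j => Measurable.imp measurable_const
    (measurableSet_setOfPred.1 (measurableSet_le (by fun_prop) (by fun_prop))))

theorem measurable_measure_marksBelow (F : Measure ℝ) [IsProbabilityMeasure F] (n : ℕ∞) :
    Measurable fun s => markedGapLaw F (marksBelow n s) :=
  measurable_measure_prodMk_left (measurableSet_marksBelow n)

theorem consSeq_mem_marksBelow (n : ℕ∞) (s a u : ℝ) (z : (ℕ → ℝ) × (ℕ → ℝ)) :
    (consSeq a z.1, consSeq u z.2) ∈ marksBelow (n + 1) s ↔
      u ≤ s + a ∧ z ∈ marksBelow n (s + a) := by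
  have h (j : ℕ) : ((j + 1 : ℕ) : ℕ∞) < n + 1 ↔ (j : ℕ∞) < n := by
    rw [Nat.cast_add, Nat.cast_one]
    exact ENat.add_lt_add_iff_right (by simp)
  have h0 : ((0 : ℕ) : ℕ∞) < n + 1 := by simp
  simp only [marksBelow, mem_ofPred_eq, arrival_consSeq]
  constructor
  · intro hz
    refine ⟨hz 0 h0, fun j hj => ?_⟩
    simpa [add_assoc] using hz (j + 1) ((h j).2 hj)
  · rintro ⟨hz0, hz⟩ j hj
    cases j with
    | zero => exact hz0
    | succ j => simpa [add_assoc] using hz j ((h j).1 hj)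

/-- The renewal recursion, obtained by conditioning on the first point. For `n = ⊤` it is an
equation, as `⊤ + 1 = ⊤`. -/
theorem markedGapLaw_marksBelow_add_one (F : Measure ℝ) [IsProbabilityMeasure F] (n : ℕ∞)
    (s : ℝ) : markedGapLaw F (marksBelow (n + 1) s) =
    ∫⁻ a in Ioi 0, ENNReal.ofReal (Real.exp (-a)) *
      (F (Iic (s + a)) * markedGapLaw F (marksBelow n (s + a))) := by
  have hm (n s) : MeasurableSet (marksBelow n s) :=
    (measurableSet_marksBelow n).preimage measurable_prodMk_left
  have hF : Measurable fun a => F (Iic (s + a)) :=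
    measurable_measure_prodMk_left (s := {y : ℝ × ℝ | y.2 ≤ s + y.1})
      (measurableSet_le (by fun_prop) (by fun_prop))
  have hR : Measurable fun a => F (Iic (s + a)) * markedGapLaw F (marksBelow n (s + a)) :=
    hF.mul ((measurable_measure_marksBelow F n).comp (measurable_const.add measurable_id))
  rw [← lintegral_expMeasure_one hR, ← lintegral_indicator_one (hm _ _),
    lintegral_markedGapLaw F (measurable_one.indicator (hm _ _))]
  have key (c : ℝ × ℝ) : ∫⁻ z, (marksBelow (n + 1) s).indicator 1 (consSeq c.1 z.1, consSeq c.2 z.2)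
      ∂markedGapLaw F = (Iic (s + c.1)).indicator 1 c.2 *
        markedGapLaw F (marksBelow n (s + c.1)) := by
    rw [← lintegral_indicator_one (hm _ _),
      ← lintegral_const_mul _ (measurable_one.indicator (hm _ _))]
    refine lintegral_congr fun z => ?_
    by_cases h1 : c.2 ≤ s + c.1 <;> by_cases h2 : z ∈ marksBelow n (s + c.1) <;>
      simp [indicator, consSeq_mem_marksBelow, h1, h2]
  simp_rw [key]
  have hL : Measurable fun c : ℝ × ℝ => (Iic (s + c.1)).indicator (1 : ℝ → ℝ≥0∞) c.2 *
      markedGapLaw F (marksBelow n (s + c.1)) := by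
    refine Measurable.mul ?_ ((measurable_measure_marksBelow F n).comp
      (measurable_const.add measurable_fst))
    exact measurable_one.indicator (s := {c : ℝ × ℝ | c.2 ≤ s + c.1})
      (measurableSet_le (by fun_prop) (by fun_prop))
  rw [lintegral_prod _ hL.aemeasurable]
  refine lintegral_congr fun a => ?_
  simp only
  rw [lintegral_mul_const _ (measurable_one.indicator measurableSet_Iic),
    lintegral_indicator_one measurableSet_Iic]

/-- The value `exp (-W(1) e⁻ˢ)` which, for `s ≥ 0`, is the probability that every mark is at most
its point shifted by `s`. -/
noncomputable def voidProb (s : ℝ) : ℝ := Real.exp (-(lambertW 1 * Real.exp (-s)))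

theorem one_sub_fStarTail {s : ℝ} (hs : 0 ≤ s) :
    1 - fStarTail s = 1 - lambertW 1 * Real.exp (-s) := by simp [fStarTail, hs]

theorem fStarTail_le_exp_neg {s : ℝ} (hs : 0 ≤ s) : fStarTail s ≤ Real.exp (-s) := by
  simp only [fStarTail, hs, if_true]
  exact mul_le_of_le_one_left (Real.exp_nonneg _) lambertW_one_le_one

theorem fStarTail_le_one (s : ℝ) : fStarTail s ≤ 1 := by
  by_cases hs : 0 ≤ s
  · exact (fStarTail_le_exp_neg hs).trans (Real.exp_le_one_iff.2 (by linarith))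
  · simp [fStarTail, hs]

/-- `voidProb` solves the renewal equation of the void probabilities. The lower limit `c = -s`
serves negative shifts `s`, for which smaller first points are impossible. -/
theorem lintegral_voidProb {s c : ℝ} (hs : 0 ≤ s + c) :
    ∫⁻ a in Ioi c, ENNReal.ofReal
      (Real.exp (-a) * ((1 - fStarTail (s + a)) * voidProb (s + a))) =
      ENNReal.ofReal (Real.exp (-c) * voidProb (s + c)) := by
  have hd (x : ℝ) : HasDerivAt (fun x => -(Real.exp (-x) * voidProb (s + x)))
      (Real.exp (-x) * ((1 - lambertW 1 * Real.exp (-(s + x))) * voidProb (s + x))) x := by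
    have h1 : HasDerivAt (fun x : ℝ => Real.exp (-(s + x))) (-Real.exp (-(s + x))) x := by
      simpa using ((hasDerivAt_id x).const_add s).neg.exp
    have h2 : HasDerivAt (fun x : ℝ => voidProb (s + x))
        (voidProb (s + x) * -(lambertW 1 * -Real.exp (-(s + x)))) x :=
      (h1.const_mul (lambertW 1)).neg.exp
    convert! ((hasDerivAt_exp_neg x).mul h2).neg using 1
    ring
  have hl : Filter.Tendsto (fun x => -(Real.exp (-x) * voidProb (s + x))) Filter.atTop
      (nhds 0) := by
    have h : Filter.Tendsto (fun x => Real.exp (-x) * voidProb (s + x)) Filter.atTop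
        (nhds 0) := by
      refine squeeze_zero (fun x => by unfold voidProb; positivity) (fun x => ?_)
        Real.tendsto_exp_neg_atTop_nhds_zero
      refine mul_le_of_le_one_right (Real.exp_nonneg _) (Real.exp_le_one_iff.2 ?_)
      have := lambertW_one_pos
      have : 0 ≤ lambertW 1 * Real.exp (-(s + x)) := by positivity
      linarith
    simpa using h.neg
  have hpos (x : ℝ) (hx : x ∈ Ioi c) : 0 ≤ Real.exp (-x) *
      ((1 - lambertW 1 * Real.exp (-(s + x))) * voidProb (s + x)) := by
    have hx' : 0 ≤ s + x := by linarith [mem_Ioi.1 hx]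
    rw [← one_sub_fStarTail hx']
    have := fStarTail_le_one (s + x)
    have : 0 ≤ 1 - fStarTail (s + x) := by linarith
    unfold voidProb; positivity
  have h := lintegral_Ioi_of_hasDerivAt hd hpos hl
  rw [zero_sub, neg_neg] at h
  rw [← h]
  refine setLIntegral_congr_fun measurableSet_Ioi fun x hx => ?_
  rw [one_sub_fStarTail (by linarith [mem_Ioi.1 hx])]

/-- The finite void probabilities approach `voidProb` geometrically fast: each step of the renewal
recursion halves the error, since `e⁻ᵃ` has mean `1 / 2` under the exponential law. -/
theorem markedGapLaw_marksBelow_bounds (n : ℕ) {s : ℝ} (hs : 0 ≤ s) :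
    ENNReal.ofReal (voidProb s) ≤ markedGapLaw fStarMeasure (marksBelow n s) ∧
      markedGapLaw fStarMeasure (marksBelow n s) ≤
        ENNReal.ofReal (voidProb s) + ENNReal.ofReal (Real.exp (-s)) * 2⁻¹ ^ n := by
  induction n generalizing s with
  | zero =>
    have h0 : marksBelow ((0 : ℕ) : ℕ∞) s = univ := by simp [marksBelow, ofPred_true]
    rw [h0, measure_univ, pow_zero, mul_one,
      ← ENNReal.ofReal_add (by unfold voidProb; positivity) (Real.exp_nonneg _),
      ← ENNReal.ofReal_one]
    have h1 := lambertW_one_pos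
    have h2 := fStarTail_le_exp_neg hs
    simp only [fStarTail, hs, if_true] at h2
    constructor
    · refine ENNReal.ofReal_le_ofReal (Real.exp_le_one_iff.2 ?_)
      have : 0 ≤ lambertW 1 * Real.exp (-s) := by positivity
      linarith
    · refine ENNReal.ofReal_le_ofReal ?_
      have := Real.add_one_le_exp (-(lambertW 1 * Real.exp (-s)))
      unfold voidProb
      linarith
  | succ n ih =>
    rw [Nat.cast_add, Nat.cast_one, markedGapLaw_marksBelow_add_one]
    have hv := lintegral_voidProb (s := s) (c := 0) (by simpa using hs)
    simp only [neg_zero, Real.exp_zero, one_mul, add_zero] at hv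
    have hF (a : ℝ) : 0 ≤ 1 - fStarTail (s + a) := by linarith [fStarTail_le_one (s + a)]
    have hsplit (a : ℝ) : ENNReal.ofReal
        (Real.exp (-a) * ((1 - fStarTail (s + a)) * voidProb (s + a))) =
        ENNReal.ofReal (Real.exp (-a)) *
          (fStarMeasure (Iic (s + a)) * ENNReal.ofReal (voidProb (s + a))) := by
      rw [ENNReal.ofReal_mul (Real.exp_nonneg _), ENNReal.ofReal_mul (hF a), fStarMeasure_Iic]
    simp_rw [hsplit] at hv
    constructor
    · rw [← hv]
      refine setLIntegral_mono' measurableSet_Ioi fun a ha => ?_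
      gcongr
      exact (ih (by linarith [mem_Ioi.1 ha])).1
    · have he : ∫⁻ a in Ioi 0, ENNReal.ofReal (Real.exp (-a)) *
          (ENNReal.ofReal (Real.exp (-(s + a))) * 2⁻¹ ^ n) =
          ENNReal.ofReal (Real.exp (-s)) * 2⁻¹ ^ (n + 1) := by
        rw [← lintegral_expMeasure_one (f := fun a =>
          ENNReal.ofReal (Real.exp (-(s + a))) * 2⁻¹ ^ n) (by fun_prop)]
        simp_rw [neg_add, Real.exp_add, ENNReal.ofReal_mul (Real.exp_nonneg _)]
        rw [lintegral_mul_const _ (by fun_prop), lintegral_const_mul _ (by fun_prop),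
          lintegral_exp_neg_expMeasure_one, mul_assoc, pow_succ']
      rw [← hv, ← he, ← lintegral_add_right _ (by fun_prop)]
      refine setLIntegral_mono' measurableSet_Ioi fun a ha => ?_
      rw [← mul_add]
      gcongr
      calc fStarMeasure (Iic (s + a)) * markedGapLaw fStarMeasure (marksBelow n (s + a))
          ≤ fStarMeasure (Iic (s + a)) * (ENNReal.ofReal (voidProb (s + a)) +
              ENNReal.ofReal (Real.exp (-(s + a))) * 2⁻¹ ^ n) := by
            gcongr
            exact (ih (by linarith [mem_Ioi.1 ha])).2
        _ ≤ _ := by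
            rw [mul_add]
            exact add_le_add le_rfl (mul_le_of_le_one_left bot_le prob_le_one)

theorem markedGapLaw_marksBelow_top {s : ℝ} (hs : 0 ≤ s) :
    markedGapLaw fStarMeasure (marksBelow ⊤ s) = ENNReal.ofReal (voidProb s) := by
  have hm (n s) : MeasurableSet (marksBelow n s) :=
    (measurableSet_marksBelow n).preimage measurable_prodMk_left
  apply le_antisymm
  · have ht : Filter.Tendsto (fun n : ℕ => ENNReal.ofReal (voidProb s) +
        ENNReal.ofReal (Real.exp (-s)) * 2⁻¹ ^ n) Filter.atTop
        (nhds (ENNReal.ofReal (voidProb s))) := by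
      have := ENNReal.Tendsto.const_mul (a := ENNReal.ofReal (Real.exp (-s)))
        (ENNReal.tendsto_pow_atTop_nhds_zero_of_lt_one (r := 2⁻¹)
          (ENNReal.inv_lt_one.2 (by norm_num))) (Or.inr ENNReal.ofReal_ne_top)
      simpa using this.const_add (ENNReal.ofReal (voidProb s))
    refine ge_of_tendsto' ht fun n => (measure_mono fun z hz => ?_).trans
      (markedGapLaw_marksBelow_bounds n hs).2
    exact fun j _ => hz j (ENat.natCast_lt_top j)
  · have hi : marksBelow ⊤ s = ⋂ n : ℕ, marksBelow n s := by
      ext z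
      simp only [marksBelow, mem_ofPred_eq, mem_iInter]
      exact ⟨fun h _ j _ => h j (ENat.natCast_lt_top j),
        fun h j _ => h (j + 1) j (by exact_mod_cast j.lt_succ_self)⟩
    have hanti : Antitone fun n : ℕ => marksBelow n s := fun n m hnm z hz j hj =>
      hz j (hj.trans_le (by exact_mod_cast hnm))
    rw [hi]
    exact ge_of_tendsto' (tendsto_measure_iInter_atTop
      (fun n => (hm n s).nullMeasurableSet) hanti ⟨0, measure_ne_top _ _⟩)
      fun n => (markedGapLaw_marksBelow_bounds n hs).1

/-- For `r > 0` the event concerns the process shifted by `-r`. In the renewal recursion a first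
point below `r` contributes nothing, and from `r` onwards the shift is nonnegative. -/
theorem markedGapLaw_allAbove (r : ℝ) : markedGapLaw fStarMeasure (allAbove r) =
    if r ≤ 0 then 1 else ENNReal.ofReal (lambertW 1 * Real.exp (-r)) := by
  split_ifs with hr
  · have : allAbove r = univ := by
      ext z; simp [allAbove, hr]
    rw [this, measure_univ]
  · have hr' := not_le.1 hr
    have h1 : allAbove r = marksBelow (⊤ + 1) (-r) := by
      ext z
      simp only [allAbove, marksBelow, mem_ofPred_eq, max_eq_left hr'.le, le_max_iff, hr, or_false,
        top_add, ENat.natCast_lt_top, true_imp_iff]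
      exact forall_congr' fun j => ⟨fun h => by linarith, fun h => by linarith⟩
    have h2 := lintegral_voidProb (s := -r) (c := r) (by simp)
    have h3 : voidProb 0 = lambertW 1 := by simp [voidProb, exp_neg_lambertW_one]
    rw [neg_add_cancel, h3, mul_comm] at h2
    rw [h1, markedGapLaw_marksBelow_add_one, ← h2, ← lintegral_indicator measurableSet_Ioi,
      ← lintegral_indicator measurableSet_Ioi]
    refine lintegral_congr_ae ?_
    filter_upwards [Measure.ae_ne volume r] with a ha
    rcases lt_or_gt_of_ne ha with ha | ha
    · have h4 : fStarMeasure (Iic (-r + a)) = 0 := by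
        simp [fStarMeasure_Iic, fStarTail, ha.not_ge]
      simp [indicator, ha.not_gt, h4]
    · have h5 : 0 ≤ -r + a := by linarith
      rw [indicator_of_mem (mem_Ioi.2 (hr'.trans ha)), indicator_of_mem (mem_Ioi.2 ha),
        markedGapLaw_marksBelow_top h5, fStarMeasure_Iic, ENNReal.ofReal_mul (Real.exp_nonneg _),
        ENNReal.ofReal_mul (by linarith [fStarTail_le_one (-r + a)])]

/-! ### The expected cost -/

theorem lintegral_allAbove_sub {x : ℝ} (hx : 0 < x) :
    ∫⁻ u, markedGapLaw fStarMeasure (allAbove (x - u)) ∂fStarMeasure =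
      ENNReal.ofReal (Real.exp (-x) *
        (2 * lambertW 1 - lambertW 1 ^ 2 + lambertW 1 ^ 2 * x)) := by
  have hw := lambertW_one_pos
  have hw' := lambertW_one_le_one
  have hm : Measurable fun u => markedGapLaw fStarMeasure (allAbove (x - u)) :=
    measurable_measure_prodMk_left (measurableSet_allAbove.preimage
      (f := fun y : ℝ × ((ℕ → ℝ) × (ℕ → ℝ)) => (x - y.1, y.2)) (by fun_prop))
  -- The integral over the exponential part splits at `u = x`, where `(x - u)⁺` vanishes.
  rw [lintegral_fStarMeasure hm, ← Ioo_union_Ici_eq_Ioi hx,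
    lintegral_union measurableSet_Ici
      (Set.disjoint_left.2 fun u h1 h2 => h1.2.not_ge (mem_Ici.1 h2)),
    setLIntegral_congr_fun (g := fun _ => ENNReal.ofReal (lambertW 1 * Real.exp (-x)))
      measurableSet_Ioo fun u hu => ?_,
    setLIntegral_congr_fun (g := fun u => ENNReal.ofReal (Real.exp (-u)))
      measurableSet_Ici fun u hu => ?_,
    setLIntegral_const, Real.volume_Ioo, setLIntegral_congr Ioi_ae_eq_Ici.symm,
    lintegral_Ioi_exp_neg, markedGapLaw_allAbove]
  · simp only [sub_zero, hx.not_ge, if_false]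
    have h1 : 0 ≤ 1 - lambertW 1 := by linarith
    rw [← ENNReal.ofReal_mul h1, ← ENNReal.ofReal_mul (by positivity),
      ← ENNReal.ofReal_add (by positivity) (by positivity), ← ENNReal.ofReal_mul hw.le,
      ← ENNReal.ofReal_add (by positivity) (by positivity)]
    congr 1
    ring
  · simp [markedGapLaw_allAbove, mem_Ici.1 hu]
  · simp only [markedGapLaw_allAbove, sub_nonpos, hu.2.not_ge, if_false]
    rw [← ENNReal.ofReal_mul (Real.exp_nonneg _), mul_left_comm, ← Real.exp_add]
    congr 3
    ring

theorem lintegral_minimiserCost_fStarMeasure :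
    ∫⁻ z, minimiserCost (arrival z.1) z.2 ∂markedGapLaw fStarMeasure =
      ENNReal.ofReal (2 * lambertW 1 + lambertW 1 ^ 2) := by
  have hw := lambertW_one_pos
  have hw' := lambertW_one_le_one
  set α := 2 * lambertW 1 - lambertW 1 ^ 2 with hα
  set β := lambertW 1 ^ 2 with hβ
  have hα0 : 0 ≤ α := by nlinarith
  have hβ0 : 0 ≤ β := by positivity
  -- The antiderivative of `x e⁻ˣ (α + β x)`, with value `-(α + 2 β)` at `0`.
  have hd (x : ℝ) : HasDerivAt
      (fun x => -(Real.exp (-x) * (β * x ^ 2 + (α + 2 * β) * x + (α + 2 * β))))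
      (x * (Real.exp (-x) * (α + β * x))) x := by
    have h1 : HasDerivAt (fun x : ℝ => β * x ^ 2 + (α + 2 * β) * x + (α + 2 * β))
        (β * (2 * x) + (α + 2 * β)) x := by
      simpa using (((hasDerivAt_pow 2 x).const_mul β).add
        ((hasDerivAt_id x).const_mul (α + 2 * β))).add_const (α + 2 * β)
    convert! ((hasDerivAt_exp_neg x).mul h1).neg using 1
    ring
  have hl : Filter.Tendsto
      (fun x => -(Real.exp (-x) * (β * x ^ 2 + (α + 2 * β) * x + (α + 2 * β))))
      Filter.atTop (nhds 0) := by
    have h2 := (Real.tendsto_pow_mul_exp_neg_atTop_nhds_zero 2).const_mul β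
    have h1 := (Real.tendsto_pow_mul_exp_neg_atTop_nhds_zero 1).const_mul (α + 2 * β)
    have h0 := (Real.tendsto_pow_mul_exp_neg_atTop_nhds_zero 0).const_mul (α + 2 * β)
    have h := ((h2.add h1).add h0).neg
    simp only [mul_zero, add_zero, neg_zero] at h
    exact h.congr fun x => by ring
  have h := lintegral_Ioi_of_hasDerivAt (a := 0) hd
    (fun x hx => by have := mem_Ioi.1 hx; positivity) hl
  rw [lintegral_minimiserCost]
  convert h using 1
  · refine setLIntegral_congr_fun measurableSet_Ioi fun x hx => ?_
    rw [lintegral_allAbove_sub hx, ENNReal.ofReal_mul (le_of_lt hx)]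
  · congr 1
    simp only [neg_zero, Real.exp_zero, hα, hβ]
    ring

/-! ### The root of the tree -/

theorem singleton_mem_optCover_root {ξ : List ℕ → ℕ → ℝ} {X : List ℕ → List ℕ → ℝ} {i : ℕ} :
    [i] ∈ optCover ξ X [] ↔
      ∀ j, max (ξ [] i - X [] [i]) 0 ≤ max (ξ [] j - X [] [j]) 0 := by
  simp only [optCover, mem_ofPred_eq, SimpleGraph.mem_neighborSet, tree_adj_root, isMinOn_iff]
  constructor
  · rintro ⟨-, h⟩ j
    simpa [edgeLength_child] using h [j] ⟨j, rfl⟩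
  · refine fun h => ⟨⟨i, rfl⟩, ?_⟩
    rintro _ ⟨j, rfl⟩
    simpa [edgeLength_child] using h j

theorem rootCost_eq_minimiserCost (ξ : List ℕ → ℕ → ℝ) (X : List ℕ → List ℕ → ℝ) :
    rootCost ξ X = minimiserCost (ξ []) fun i => X [] [i] := by
  classical
  unfold rootCost minimiserCost
  rw [tsum_subtype (optCover ξ X []) fun v => ENNReal.ofReal (edgeLength ξ [] v),
    ← Function.Injective.tsum_eq (g := fun i : ℕ => [i]) (fun i j h => by simpa using h)]
  · refine tsum_congr fun i => ?_
    rw [indicator_apply, (edgeLength_child ξ [] i).1]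
    exact if_congr singleton_mem_optCover_root rfl rfl
  · intro v hv
    have hv' : v ∈ optCover ξ X [] := mem_of_indicator_ne_zero hv
    obtain ⟨i, rfl⟩ := (tree_adj_root v).1 hv'.1
    exact ⟨i, rfl⟩

/-- The gaps between consecutive terms of `t`, the first one being measured from `0`. -/
def gaps (t : ℕ → ℝ) (i : ℕ) : ℝ := t i - if i = 0 then 0 else t (i - 1)

theorem arrival_gaps (t : ℕ → ℝ) : arrival (gaps t) = t := by
  funext n
  induction n with
  | zero => simp [arrival, partialSum, gaps]
  | succ n ih =>
    have h : arrival (gaps t) (n + 1) = arrival (gaps t) n + gaps t (n + 1) :=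
      Finset.sum_range_succ _ _
    rw [h, ih]
    simp [gaps]

theorem measurable_gaps : Measurable gaps := by
  refine measurable_pi_iff.2 fun i => ?_
  unfold gaps
  split_ifs <;> fun_prop

theorem IsUnitPoissonProcess.aemeasurable {Ω : Type*} [MeasurableSpace Ω] {μ : Measure Ω}
    {τ : ℕ → Ω → ℝ} (h : IsUnitPoissonProcess τ μ) (i : ℕ) : AEMeasurable (τ i) μ := by
  induction i with
  | zero => exact h.1.aemeasurable
  | succ i ih =>
    have := (h.2.1 i).aemeasurable.add ih
    exact this.congr (ae_of_all _ fun ω => by simp)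

theorem IsUnitPoissonProcess.hasLaw_gaps {Ω : Type*} [MeasurableSpace Ω] {μ : Measure Ω}
    {τ : ℕ → Ω → ℝ} (h : IsUnitPoissonProcess τ μ) :
    HasLaw (fun ω => gaps fun i => τ i ω) (Measure.infinitePi fun _ => expMeasure 1) μ := by
  refine iIndepFun.hasLaw_infinitePi (X := fun i ω => gaps (fun i => τ i ω) i) (fun i => ?_) h.2.2
    (measurable_gaps.comp_aemeasurable (aemeasurable_pi_iff.2 h.aemeasurable))
  cases i with
  | zero => simpa [gaps] using h.1
  | succ i => simpa [gaps] using h.2.1 i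

theorem IsTreeProcess.hasLaw_root {Ω : Type*} [MeasurableSpace Ω] {μ : Measure Ω}
    [IsProbabilityMeasure μ] {ξ : List ℕ → ℕ → Ω → ℝ} {X : List ℕ → List ℕ → Ω → ℝ}
    (h : IsTreeProcess ξ X μ) :
    HasLaw (fun ω => (gaps fun i => ξ [] i ω, fun i => X [] [i] ω)) (markedGapLaw fStarMeasure)
      μ := by
  have h1 := (h.pwit.poisson []).hasLaw_gaps
  have h2 : HasLaw (fun ω i => X [] [i] ω) (Measure.infinitePi fun _ : ℕ => fStarMeasure) μ := by
    refine iIndepFun.hasLaw_infinitePi (X := fun i ω => X [] [i] ω)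
      (fun i => (h.law [] i).hasLaw) ?_ (aemeasurable_pi_iff.2 fun i => (h.law [] i).1)
    exact (h.indep_level 0).precomp (g := fun i : ℕ => (⟨[], rfl⟩, i))
      fun i j hij => (Prod.mk.inj hij).2
  have h3 : IndepFun (fun ω => gaps fun i => ξ [] i ω) (fun ω i => X [] [i] ω) μ := by
    have := (h.indep_length 0).comp
      (φ := fun (x : {v : List ℕ // v.length = 0} × ℕ → ℝ) (i : ℕ) => x (⟨[], rfl⟩, i))
      (ψ := fun (y : {v : List ℕ // v.length ≤ 0} × ℕ → ℝ) =>
        gaps fun i => y (⟨[], le_rfl⟩, i)) (by fun_prop)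
      (measurable_gaps.comp (by fun_prop))
    exact this.symm
  refine ⟨h1.aemeasurable.prodMk h2.aemeasurable, ?_⟩
  rw [(indepFun_iff_map_prod_eq_prod_map_map h1.aemeasurable h2.aemeasurable).1 h3, h1.map_eq,
    h2.map_eq]
  rfl

theorem measurable_minimiserCost_arrival :
    Measurable fun z : (ℕ → ℝ) × (ℕ → ℝ) => minimiserCost (arrival z.1) z.2 :=
  measurable_minimiserCost.comp ((measurable_arrival.comp measurable_fst).prodMk measurable_snd)

theorem lintegral_minimiserCost_of_hasLaw {Ω : Type*} [MeasurableSpace Ω] {μ : Measure Ω}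
    {S : Ω → (ℕ → ℝ) × (ℕ → ℝ)} (hS : HasLaw S (markedGapLaw fStarMeasure) μ) :
    AEMeasurable (fun ω => minimiserCost (arrival (S ω).1) (S ω).2) μ ∧
      ∫⁻ ω, minimiserCost (arrival (S ω).1) (S ω).2 ∂μ =
        ENNReal.ofReal (2 * lambertW 1 + lambertW 1 ^ 2) := by
  have hm := measurable_minimiserCost_arrival
  exact ⟨hm.comp_aemeasurable hS.aemeasurable,
    (hS.lintegral_comp hm.aemeasurable).trans lintegral_minimiserCost_fStarMeasure⟩

end PWIT

theorem mainTheorem5 {Ω : Type*} [MeasurableSpace Ω] (μ : MeasureTheory.Measure Ω)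
    [MeasureTheory.IsProbabilityMeasure μ]
    (ξ : List ℕ → ℕ → Ω → ℝ) (X : List ℕ → List ℕ → Ω → ℝ)
    (h : PWIT.IsTreeProcess ξ X μ) :
    AEMeasurable (fun ω => PWIT.rootCost (fun v i => ξ v i ω) (fun u v => X u v ω)) μ ∧
    ∫⁻ ω, PWIT.rootCost (fun v i => ξ v i ω) (fun u v => X u v ω) ∂μ =
      ENNReal.ofReal (2 * PWIT.lambertW 1 + PWIT.lambertW 1 ^ 2) := by
  have hcost : (fun ω => PWIT.rootCost (fun v i => ξ v i ω) (fun u v => X u v ω)) =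
      fun ω => PWIT.minimiserCost (PWIT.arrival (PWIT.gaps fun i => ξ [] i ω))
        fun i => X [] [i] ω := by
    funext ω
    rw [PWIT.rootCost_eq_minimiserCost, PWIT.arrival_gaps]
  have hroot := PWIT.lintegral_minimiserCost_of_hasLaw h.hasLaw_root
  rw [hcost]
  exact hroot
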